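/- Let $(W,S)$ be a Coxeter system with $W$ finite, where $W$ has the presentation $\langle s\in S \mid (st)^{n(s,t)}=e \text{ whenever } n(s,t)<\infty\rangle$, with $n(s,s)=1$ and $1<n(s,t)=n(t,s)\le\infty$ for $s\ne t$. Let $H$ be its Hecke algebra over $\mathbb{Q}(u)$, that is, the $\mathbb{Q}(u)$-algebra with generators $T_s$ $(s\in S)$ and relations $(T_s-u^2)(T_s+1)=0$ for $s\in S$ and $T_sT_tT_s\cdots=T_tT_sT_t\cdots$ ($n(s,t)$ factors on each side) for $s,t\in S$ with $1<n(s,t)<\infty$. An $S$-labeled digraph $\Gamma$ is a (not necessarily finite) directed multigraph without loops, each of whose edges is either solid or dashed and is labeled by an element of $S$, such that for every $s\in S$ each vertex occurs in exactly one edge labeled $s$. Let $M(\Gamma)$ be the $\mathbb{Q}(u)$-vector space whose basis is the vertex set of $\Gamma$, and for $s\in S$ let $\tau_s$ be the linear operator on $M(\Gamma)$ such that, for a vertex $\alpha$, with $\beta$ the other end of the edge labeled $s$ at $\alpha$, $$\tau_s(\alpha)=\begin{cases}\beta & \text{if the edge is solid and directed from }\alpha\text{ to }\beta,\\ (u^2-1)\alpha+u^2\beta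 & \text{if the edge is solid and directed from }\beta\text{ to }\alpha,\\ u\alpha+(u+1)\beta & \text{if the edge is dashed and directed from }\alpha\text{ to }\beta,\\ (u^2-u-1)\alpha+(u^2-u)\beta & \text{if the edge is dashed and directed from }\beta\text{ to }\alpha.\end{cases}$$ $\Gamma$ is a $W$-digraph if $T_s\mapsto\tau_s$ extends to a homomorphism of $\mathbb{Q}(u)$-algebras $H\to\operatorname{End}_{\mathbb{Q}(u)}(M(\Gamma))$. It is connected if its underlying undirected multigraph is connected, and connected components are those of the underlying undirected multigraph. For $J\subseteq S$, let $W_J=\langle J\rangle$ be the subgroup of $W$ generated by $J$, and let $\Gamma_J$ be the $J$-labeled digraph with the same vertices as $\Gamma$ obtained by removing all edges labeled by elements of $S\setminus J$. Theorem. If $W$ is finite, $J\subseteq S$ and $\Gamma$ is a connected $W$-digraph, then $\Gamma_J$ has at most $|W:W_J|$ connected components. -/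

import Mathlib

noncomputable section

/-- The indeterminate `u` of the field `ℚ(u)`. -/
def heckeU : RatFunc ℚ := RatFunc.X

/-- The alternating product `a * b * a * ⋯` with `n` factors, beginning with `a`. -/
def altProd {A : Type*} [Monoid A] : ℕ → A → A → A
  | 0, _, _ => 1
  | n + 1, a, b => a * altProd n b a

/-- The defining relations of the Hecke algebra (with parameter `u ^ 2`, over `ℚ(u)`) of the
Coxeter matrix `M`, in the free algebra on the index set `B`: the quadratic relations
`(T_s - u ^ 2) (T_s + 1) = 0` and the braid relations `T_s T_t ⋯ = T_t T_s ⋯` with `M s t` factors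
on both sides. The entry `0` of a Coxeter matrix stands for `∞`, so that `1 < M s t` says that
`s ≠ t` and `n(s, t)` is finite. -/
inductive HeckeRel {B : Type*} (M : CoxeterMatrix B) :
    FreeAlgebra (RatFunc ℚ) B → FreeAlgebra (RatFunc ℚ) B → Prop
  | quadratic (s : B) : HeckeRel M
      ((FreeAlgebra.ι (RatFunc ℚ) s - algebraMap (RatFunc ℚ) _ (heckeU ^ 2)) *
        (FreeAlgebra.ι (RatFunc ℚ) s + 1)) 0
  | braid (s t : B) (h : 1 < M s t) : HeckeRel M
      (altProd (M s t) (FreeAlgebra.ι (RatFunc ℚ) s) (FreeAlgebra.ι (RatFunc ℚ) t))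
      (altProd (M s t) (FreeAlgebra.ι (RatFunc ℚ) t) (FreeAlgebra.ι (RatFunc ℚ) s))

/-- The Hecke algebra `H` over `ℚ(u)` of a Coxeter system with Coxeter matrix `M`. -/
abbrev HeckeAlgebra {B : Type*} (M : CoxeterMatrix B) : Type _ := RingQuot (HeckeRel M)

/-- The generator `T_s` of the Hecke algebra. -/
def heckeT {B : Type*} (M : CoxeterMatrix B) (s : B) : HeckeAlgebra M :=
  RingQuot.mkAlgHom (RatFunc ℚ) (HeckeRel M) (FreeAlgebra.ι (RatFunc ℚ) s)

/-- An `S`-labeled digraph with vertex set `V` and edge set `E`: a directed multigraph whose edges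
are solid or dashed and labeled by elements of `S`, without loops, such that for all `s` every
vertex occurs in exactly one edge labeled `s`. -/
structure LabeledDigraph (S V E : Type*) where
  /-- The initial vertex of an edge. -/
  src : E → V
  /-- The terminal vertex of an edge. -/
  tgt : E → V
  /-- The label of an edge. -/
  label : E → S
  /-- The edges that are dashed; all others are solid. -/
  IsDashed : E → Prop
  no_loops : ∀ e, src e ≠ tgt e
  existsUnique_edge : ∀ (s : S) (v : V), ∃! e, label e = s ∧ (src e = v ∨ tgt e = v)

namespace LabeledDigraph

variable {S V E : Type*} (Γ : LabeledDigraph S V E)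

/-- The unique edge labeled `s` in which the vertex `v` occurs. -/
def edgeAt (s : S) (v : V) : E := (Γ.existsUnique_edge s v).choose

open Classical in
/-- The vector `τ_s(α)` for a vertex `α`. With `e` the edge labeled `s` at `α`, and `β` its other
end, the four cases are: `e` is dashed from `α` to `β`; solid from `α` to `β`; dashed from `β` to
`α`; solid from `β` to `α`. -/
def tauVertex (s : S) (α : V) : V →₀ RatFunc ℚ :=
  let e := Γ.edgeAt s α
  if Γ.src e = α then
    if Γ.IsDashed e then
      Finsupp.single α heckeU + Finsupp.single (Γ.tgt e) (heckeU + 1)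
    else
      Finsupp.single (Γ.tgt e) 1
  else
    if Γ.IsDashed e then
      Finsupp.single α (heckeU ^ 2 - heckeU - 1) + Finsupp.single (Γ.src e) (heckeU ^ 2 - heckeU)
    else
      Finsupp.single α (heckeU ^ 2 - 1) + Finsupp.single (Γ.src e) (heckeU ^ 2)

/-- The operator `τ_s` on the `ℚ(u)`-vector space `M(Γ)` with basis the vertices of `Γ`. -/
def tau (s : S) : Module.End (RatFunc ℚ) (V →₀ RatFunc ℚ) :=
  Finsupp.linearCombination (RatFunc ℚ) (Γ.tauVertex s)

/-- `Γ` is a `W`-digraph, for `W` the Coxeter group with Coxeter matrix `M`: the assignment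
`T_s ↦ τ_s` extends to a representation of the Hecke algebra on `M(Γ)`. -/
def IsWDigraph (M : CoxeterMatrix S) : Prop :=
  ∃ ρ : HeckeAlgebra M →ₐ[RatFunc ℚ] Module.End (RatFunc ℚ) (V →₀ RatFunc ℚ),
    ∀ s, ρ (heckeT M s) = Γ.tau s

/-- The digraph `Γ_J`, with the same vertices, obtained from `Γ` by removing all edges whose label
is not in `J`. -/
def restrict (J : Set S) : LabeledDigraph J V {e : E // Γ.label e ∈ J} where
  src e := Γ.src e
  tgt e := Γ.tgt e
  label e := ⟨Γ.label e, e.2⟩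
  IsDashed e := Γ.IsDashed e
  no_loops e := Γ.no_loops e
  existsUnique_edge := by
    rintro ⟨s, hs⟩ v
    obtain ⟨e, ⟨he, hv⟩, huniq⟩ := Γ.existsUnique_edge s v
    refine ⟨⟨e, he ▸ hs⟩, ⟨Subtype.ext he, hv⟩, ?_⟩
    rintro ⟨f, hf⟩ ⟨hfs, hfv⟩
    exact Subtype.ext (huniq f ⟨congrArg Subtype.val hfs, hfv⟩)

/-- The undirected graph underlying `Γ` (directions, types, labels and multiplicities of edges
are forgotten; multiplicities play no role for connectedness). -/
def undir : SimpleGraph V where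
  Adj α β := ∃ e, (Γ.src e = α ∧ Γ.tgt e = β) ∨ (Γ.src e = β ∧ Γ.tgt e = α)
  symm := ⟨fun _ _ ⟨e, h⟩ => ⟨e, h.symm⟩⟩
  loopless := ⟨by
    rintro α ⟨e, ⟨h₁, h₂⟩ | ⟨h₁, h₂⟩⟩ <;> exact Γ.no_loops e (h₁.trans h₂.symm)⟩

/-- `Γ` is connected if its underlying undirected graph is. -/
def IsConnected : Prop := Γ.undir.Connected

/-- The set of connected components of `Γ`. -/
abbrev Component : Type _ := Γ.undir.ConnectedComponent

end LabeledDigraph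

/-- The parabolic subgroup `W_J` generated by the simple reflections in `J`. -/
def CoxeterSystem.parabolic {B W : Type*} [Group W] {M : CoxeterMatrix B}
    (cs : CoxeterSystem M W) (J : Set B) : Subgroup W :=
  Subgroup.closure (cs.simple '' J)

end

/-! Write q = u² and T_w for the product of the operators τ_s along a reduced word of w. As Γ is
connected and the coefficient of β in τ_s(α) never vanishes, a single vertex v generates M(Γ), so
the vectors T_w v span it (`span_reducedProd_tau_eq_top`); in particular Γ has finitely many
vertices.

Let e be the sum of the T_w over w in W_J. For s in J one has e T_s = q e (`parabolicSum_mul`), so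
up to a nonzero scalar e T_w depends only on the coset W_J w, and the image of e is spanned by |W :
W_J| vectors. On the other hand, the sum of the vertices of a component of Γ_J is an eigenvector of
each τ_s with s in J, with eigenvalue q (`tau_sum_single`). Hence e multiplies it by the sum of the
q^ℓ(w) over W_J, which is nonzero, and the component sum lies in the image of e. Component sums have
disjoint supports, so they are linearly independent, and their number is at most |W : W_J|.

That T_w does not depend on the reduced word is Matsumoto's theorem (`prod_map_eq_of_isReduced`).
Its proof uses the exchange property, from an action of W on signed group elements, and the fact
that no smaller power of s_i s_j than the M i j-th is trivial, from the geometric representation. -/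

section DihedralReflections

/-! ### Powers of a product of two reflections -/

open Module Polynomial.Chebyshev

variable {V : Type*} [AddCommGroup V] [Module ℝ V] {x y : V} {f g : Dual ℝ V}

theorem Real.sin_two_pi_div_ne_zero {m : ℕ} (hm : 3 ≤ m) : Real.sin (2 * Real.pi / m) ≠ 0 := by
  have h3 : (3 : ℝ) ≤ m := by exact_mod_cast hm
  apply ne_of_gt
  apply Real.sin_pos_of_pos_of_lt_pi
  · positivity
  · rw [div_lt_iff₀ (by linarith)]
    nlinarith [Real.pi_pos]

/-- The powers have coefficients built from Chebyshev polynomials S_n at 2 cos θ, θ = 2π/m, where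
S_n(2 cos θ) sin θ = sin((n+1)θ). For m = 2k the factor S_{k-1} vanishes, for m = 2k+1 the factor
S_k + S_{k-1} does. The case m = 2 is separate because then sin θ = 0. -/
theorem Module.reflection_mul_reflection_pow_eq_one (hf : f x = 2) (hg : g y = 2) {m : ℕ}
    (hm : 2 ≤ m) (hfy : f y = -2 * Real.cos (Real.pi / m))
    (hgx : g x = -2 * Real.cos (Real.pi / m)) :
    (reflection hf * reflection hg) ^ m = 1 := by
  have ht : 2 * Real.cos (2 * Real.pi / m) = f y * g x - 2 := by
    rw [hfy, hgx, mul_div_assoc, Real.cos_two_mul]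
    ring
  have hS := fun n => S_two_mul_real_cos (2 * Real.pi / m) n
  have hm0 : (m : ℝ) ≠ 0 := by positivity
  ext z
  rw [reflection_mul_reflection_pow_apply hf hg m z _ ht]
  rcases hm.eq_or_lt with rfl | hm3
  · have hc : f y = 0 ∧ g x = 0 := by simp [hfy, hgx]
    simp [hc.1, hc.2, S_one]
    module
  have hs := Real.sin_two_pi_div_ne_zero hm3
  rcases Nat.even_or_odd' m with ⟨k, hk | hk⟩
  · have h1 : ((m : ℤ) - 2) / 2 = k - 1 := by omega
    have h2 : ((m : ℤ) - 1) / 2 = k - 1 := by omega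
    have h0 : (S ℝ ((k : ℤ) - 1)).eval (2 * Real.cos (2 * Real.pi / m)) = 0 := by
      refine (mul_eq_zero.mp ((hS _).trans ?_)).resolve_right hs
      have : (((k : ℤ) - 1 : ℤ) + 1 : ℝ) * (2 * Real.pi / m) = Real.pi := by
        have hkm : (m : ℝ) = 2 * k := by exact_mod_cast hk
        field_simp
        push_cast
        rw [hkm]
        ring
      rw [this, Real.sin_pi]
    simp [h1, h2, h0]
  · have h1 : ((m : ℤ) - 2) / 2 = k - 1 := by omega
    have h2 : ((m : ℤ) - 1) / 2 = k := by omega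
    have h3 : ((m : ℤ) - 3) / 2 = k - 1 := by omega
    have h4 : (m : ℤ) / 2 = k := by omega
    have hkm : (m : ℝ) = 2 * k + 1 := by exact_mod_cast hk
    have h0 : (S ℝ (k : ℤ)).eval (2 * Real.cos (2 * Real.pi / m)) +
        (S ℝ ((k : ℤ) - 1)).eval (2 * Real.cos (2 * Real.pi / m)) = 0 := by
      refine (mul_eq_zero.mp ?_).resolve_right hs
      rw [add_mul, hS, hS]
      have e1 : (((k : ℤ) : ℝ) + 1) * (2 * Real.pi / m) = Real.pi / m + Real.pi := by
        field_simp
        push_cast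
        rw [hkm]
        ring
      have e2 : (((k : ℤ) - 1 : ℤ) + 1 : ℝ) * (2 * Real.pi / m) = Real.pi - Real.pi / m := by
        field_simp
        push_cast
        rw [hkm]
        ring
      rw [e1, e2, Real.sin_add_pi, Real.sin_pi_sub]
      ring
    simp [h1, h2, h3, h4, h0]

/-- If the p-th power fixes x, comparing coefficients of x and y gives S_p + S_{p-1} = 1 and S_{p-1}
· g x = 0 at 2 cos(2π/m). For m = 0 division by zero makes the angle 0, and S_{p-1}(2) = p is
nonzero. -/
theorem Module.reflection_mul_reflection_pow_ne_one (hf : f x = 2) (hg : g y = 2) {m p : ℕ}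
    (hm : m ≠ 1) (hp : 0 < p) (hpm : m = 0 ∨ p < m) (hxy : LinearIndependent ℝ ![x, y])
    (hfy : f y = -2 * Real.cos (Real.pi / m)) (hgx : g x = -2 * Real.cos (Real.pi / m)) :
    (reflection hf * reflection hg) ^ p ≠ 1 := by
  intro h
  have ht : 2 * Real.cos (2 * Real.pi / m) = f y * g x - 2 := by
    rw [hfy, hgx, mul_div_assoc, Real.cos_two_mul]
    ring
  have h1 := reflection_mul_reflection_pow_apply_self hf hg p _ ht
  rw [h] at h1
  change x = _ at h1
  have h2 := LinearIndependent.pair_iff.mp hxy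
    ((S ℝ p).eval (2 * Real.cos (2 * Real.pi / m)) +
      (S ℝ (p - 1)).eval (2 * Real.cos (2 * Real.pi / m)) - 1)
    ((S ℝ (p - 1)).eval (2 * Real.cos (2 * Real.pi / m)) * -g x) (by
      rw [sub_smul, sub_add_eq_add_sub, ← h1]; simp)
  obtain ⟨ha, hb⟩ := h2
  have hS := fun n => S_two_mul_real_cos (2 * Real.pi / m) n
  have hm' : m = 0 ∨ m = 2 ∨ 3 ≤ m := by omega
  rcases hm' with rfl | rfl | hm3
  · simp [hgx] at hb
    omega
  · obtain rfl : p = 1 := by omega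
    norm_num [S_one, mul_div_cancel_left₀] at ha
  · have hs := Real.sin_two_pi_div_ne_zero hm3
    have hmR : (3 : ℝ) ≤ m := by exact_mod_cast hm3
    have hpm' : p < m := by omega
    have hc : g x ≠ 0 := by
      rw [hgx]
      have : 0 < Real.cos (Real.pi / m) := by
        apply Real.cos_pos_of_mem_Ioo
        constructor
        · have : 0 < Real.pi / m := by positivity
          linarith [Real.pi_pos]
        · gcongr
          linarith
      linarith
    have hb' : (S ℝ (p - 1)).eval (2 * Real.cos (2 * Real.pi / m)) = 0 := by
      simpa [hc] using hb
    have hsin := hS (p - 1)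
    rw [hb', zero_mul] at hsin
    have e : (((p : ℤ) - 1 : ℤ) + 1 : ℝ) * (2 * Real.pi / m) = p * (2 * Real.pi / m) := by
      push_cast; ring
    rw [e] at hsin
    obtain ⟨n, hn⟩ := Real.sin_eq_zero_iff.mp hsin.symm
    have hnm : n * m = 2 * p := by
      have := Real.pi_pos
      field_simp at hn
      rw [mul_comm 2]
      exact_mod_cast hn
    -- Now pθ = nπ with 0 < n < 2, so pθ = π. Then S_p = 1 would say sin θ = sin(θ + π) = -sin θ.
    have hn1 : n = 1 := by
      have : 0 < n := by
        by_contra hneg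
        push Not at hneg
        nlinarith [show (0 : ℤ) < p by exact_mod_cast hp, show (0 : ℤ) ≤ m by positivity]
      have : n < 2 := by
        by_contra hneg
        push Not at hneg
        nlinarith [show (p : ℤ) < m by exact_mod_cast hpm', show (0 : ℤ) ≤ m by positivity]
      omega
    rw [hb', add_zero, sub_eq_zero] at ha
    have h3 := hS p
    have e3 : (((p : ℤ) : ℝ) + 1) * (2 * Real.pi / m) = 2 * Real.pi / m + Real.pi := by
      rw [add_mul, one_mul, Int.cast_natCast, ← hn, hn1]
      push_cast
      ring
    rw [ha, one_mul, e3, Real.sin_add_pi] at h3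
    exact hs (by linarith)

end DihedralReflections

/-! ### The geometric representation and the order of s_i s_j -/

namespace CoxeterSystem

open Module

variable {B W : Type*} [Group W] {M : CoxeterMatrix B} (cs : CoxeterSystem M W)

/-- The coroot of the geometric representation on the real vector space with basis `B`. -/
noncomputable def geomCoroot (M : CoxeterMatrix B) (i : B) : Dual ℝ (B →₀ ℝ) :=
  Finsupp.linearCombination ℝ fun j => -2 * Real.cos (Real.pi / M i j)

theorem geomCoroot_single (i j : B) :
    geomCoroot M i (Finsupp.single j 1) = -2 * Real.cos (Real.pi / M i j) := by
  simp [geomCoroot]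

theorem geomCoroot_self (i : B) : geomCoroot M i (Finsupp.single i 1) = 2 := by
  simp [geomCoroot_single]

/-- The simple reflections of the geometric representation. -/
noncomputable def geomReflection (M : CoxeterMatrix B) (i : B) : (B →₀ ℝ) ≃ₗ[ℝ] (B →₀ ℝ) :=
  reflection (geomCoroot_self (M := M) i)

theorem isLiftable_geomReflection : M.IsLiftable (geomReflection M) := by
  intro i j
  by_cases hij : i = j
  · subst hij
    ext z : 1
    simp [geomReflection, (involutive_reflection (geomCoroot_self (M := M) i)) _]
  have h1 := M.off_diagonal i j hij
  rcases Nat.eq_zero_or_pos (M i j) with h0 | h0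
  · rw [h0, pow_zero]
  exact reflection_mul_reflection_pow_eq_one _ _ (by omega) (geomCoroot_single i j)
    (by rw [geomCoroot_single, M.symmetric])

/-- The presentation only bounds the order of s_i s_j; the geometric representation shows that no
smaller positive power is trivial. The entry 0, for ∞, gives π/0 = 0 and thus the pairing -2 usual
for infinite order. -/
theorem simple_mul_simple_pow_ne_one {i j : B} (hij : i ≠ j) {p : ℕ} (hp : 0 < p)
    (hpm : M i j = 0 ∨ p < M i j) : (cs.simple i * cs.simple j) ^ p ≠ 1 := by
  intro h
  have h1 := congrArg (cs.lift ⟨_, isLiftable_geomReflection (M := M)⟩) h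
  rw [map_pow, map_mul, cs.lift_apply_simple, cs.lift_apply_simple, map_one] at h1
  refine reflection_mul_reflection_pow_ne_one _ _ (M.off_diagonal i j hij) hp hpm ?_
    (geomCoroot_single i j) (by rw [geomCoroot_single, M.symmetric]) h1
  rw [LinearIndependent.pair_iff]
  intro a b hab
  have ha := DFunLike.congr_fun hab i
  have hb := DFunLike.congr_fun hab j
  simp [hij, Ne.symm hij] at ha hb
  exact ⟨ha, hb⟩

/-! ### Signed conjugation and the exchange property -/

open Classical in
/-- The action of a simple reflection on pairs consisting of a group element, which is conjugated,
and a sign, which is changed if the group element is the simple reflection. -/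
noncomputable def signedConj (i : B) : Function.End (W × ZMod 2) :=
  fun p => (cs.simple i * p.1 * cs.simple i, p.2 + if p.1 = cs.simple i then 1 else 0)

theorem simple_mul_simple_pow_mul_simple (i j : B) (k : ℕ) :
    (cs.simple i * cs.simple j) ^ k * cs.simple i =
      cs.simple i * (cs.simple j * cs.simple i) ^ k := by
  induction k with
  | zero => simp
  | succ k ih => rw [pow_succ', mul_assoc, ih, pow_succ']; simp [mul_assoc]

-- The sign counts modulo 2 how often t occurs among the 2n reflections s_j (s_i s_j)^k met along
-- the word.
open Classical in
theorem signedConj_mul_signedConj_pow (i j : B) (n : ℕ) (t : W) (ε : ZMod 2) :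
    ((cs.signedConj i * cs.signedConj j) ^ n) (t, ε) =
      ((cs.simple i * cs.simple j) ^ n * t * (cs.simple j * cs.simple i) ^ n,
        ε + ∑ k ∈ Finset.range (2 * n),
          if t = cs.simple j * (cs.simple i * cs.simple j) ^ k then 1 else 0) := by
  induction n with
  | zero => simp; rfl
  | succ n ih =>
    rw [pow_succ']
    change cs.signedConj i (cs.signedConj j
      (((cs.signedConj i * cs.signedConj j) ^ n) (t, ε))) = _
    rw [ih]
    have hinv : ((cs.simple j * cs.simple i) ^ n) = ((cs.simple i * cs.simple j) ^ n)⁻¹ := by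
      rw [← inv_pow, mul_inv_rev, cs.inv_simple, cs.inv_simple]
    have hc1 := cs.simple_mul_simple_pow_mul_simple j i n
    ext
    · simp only [signedConj]
      rw [pow_succ' (cs.simple i * cs.simple j), pow_succ (cs.simple j * cs.simple i)]
      simp only [mul_assoc]
    · simp only [signedConj]
      rw [show 2 * (n + 1) = 2 * n + 1 + 1 by ring, Finset.sum_range_succ, Finset.sum_range_succ,
        ← add_assoc, ← add_assoc]
      have e1 : (cs.simple i * cs.simple j) ^ n * t * (cs.simple j * cs.simple i) ^ n =
          cs.simple j ↔ t = cs.simple j * (cs.simple i * cs.simple j) ^ (2 * n) := by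
        rw [hinv, mul_inv_eq_iff_eq_mul, ← eq_inv_mul_iff_mul_eq, ← hinv, ← mul_assoc, hc1,
          mul_assoc, ← pow_add, two_mul]
      have e2 : cs.simple j * ((cs.simple i * cs.simple j) ^ n * t *
          (cs.simple j * cs.simple i) ^ n) * cs.simple j = cs.simple i ↔
          t = cs.simple j * (cs.simple i * cs.simple j) ^ (2 * n + 1) := by
        rw [← eq_mul_inv_iff_mul_eq, ← eq_inv_mul_iff_mul_eq, hinv, mul_inv_eq_iff_eq_mul,
          ← eq_inv_mul_iff_mul_eq, ← hinv, cs.inv_simple]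
        rw [show (cs.simple j * cs.simple i) ^ n * (cs.simple j * (cs.simple i * cs.simple j) *
          (cs.simple i * cs.simple j) ^ n) = ((cs.simple j * cs.simple i) ^ n * cs.simple j) *
          ((cs.simple i * cs.simple j) * (cs.simple i * cs.simple j) ^ n) by
            simp only [mul_assoc], hc1, mul_assoc, ← pow_succ', ← pow_add]
        rw [show n + (n + 1) = 2 * n + 1 by ring]
      simp only [e1, e2]

/-- With n = M i j the list of 2n reflections runs twice through the same n entries, so every sign
change cancels modulo 2. -/
theorem isLiftable_signedConj : M.IsLiftable cs.signedConj := by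
  classical
  intro i j
  funext ⟨t, ε⟩
  rw [signedConj_mul_signedConj_pow, two_mul, Finset.sum_range_add]
  have h := cs.simple_mul_simple_pow i j
  have h' := cs.simple_mul_simple_pow' i j
  simp only [pow_add, h, h', one_mul, mul_one]
  rw [CharTwo.add_self_eq_zero, add_zero]
  rfl

/-- The action of `W` on signed group elements that extends `signedConj`. -/
noncomputable def signedConjHom : W →* Function.End (W × ZMod 2) :=
  cs.lift ⟨_, cs.isLiftable_signedConj⟩

theorem signedConjHom_simple (i : B) : cs.signedConjHom (cs.simple i) = cs.signedConj i :=
  cs.lift_apply_simple _ i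

/-- A letter x changes the sign only if the conjugate of t by the letters r to its right is s_x. A
total change of sign therefore exhibits a letter whose deletion amounts to multiplying by t. -/
theorem exists_of_signedConjHom_ne (ω : List B) (t : W) (ε : ZMod 2) :
    (cs.signedConjHom (cs.wordProd ω) (t, ε)).1 = cs.wordProd ω * t * (cs.wordProd ω)⁻¹ ∧
    ((cs.signedConjHom (cs.wordProd ω) (t, ε)).2 ≠ ε →
      ∃ p x r, ω = p ++ x :: r ∧ cs.simple x * cs.wordProd r = cs.wordProd r * t) := by
  induction ω with
  | nil =>
    rw [cs.wordProd_nil, map_one]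
    exact ⟨by simp; rfl, fun h => absurd rfl h⟩
  | cons i ω ih =>
    have e : cs.signedConjHom (cs.wordProd (i :: ω)) (t, ε) =
        cs.signedConj i (cs.signedConjHom (cs.wordProd ω) (t, ε)) := by
      rw [cs.wordProd_cons, map_mul, signedConjHom_simple]
      rfl
    rw [e]
    simp only [signedConj]
    rw [ih.1]
    refine ⟨by simp [cs.wordProd_cons, mul_assoc], fun h => ?_⟩
    by_cases h1 : cs.wordProd ω * t * (cs.wordProd ω)⁻¹ = cs.simple i
    · refine ⟨[], i, ω, rfl, ?_⟩
      rw [← h1]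
      group
    · rw [if_neg h1, add_zero] at h
      obtain ⟨p, x, r, rfl, hx⟩ := ih.2 h
      exact ⟨i :: p, x, r, rfl, hx⟩

/-- The exchange property, on the right. -/
theorem exists_of_isRightDescent {ω : List B} {i : B} (h : cs.IsRightDescent (cs.wordProd ω) i) :
    ∃ p x r, ω = p ++ x :: r ∧ cs.simple x * cs.wordProd r = cs.wordProd r * cs.simple i := by
  refine (cs.exists_of_signedConjHom_ne ω (cs.simple i) 0).2 ?_
  set w := cs.wordProd ω with hw
  obtain ⟨ω', hr, hω'⟩ := cs.exists_isReduced (w * cs.simple i)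
  -- Factor w as (w s_i) s_i: the first s_i fixes itself under conjugation and flips the sign to 1.
  have e : cs.signedConjHom w (cs.simple i, 0) =
      cs.signedConjHom (cs.wordProd ω') (cs.simple i, 1) := by
    conv_lhs => rw [show w = cs.wordProd ω' * cs.simple i by rw [← hω']; simp]
    rw [map_mul, signedConjHom_simple]
    change cs.signedConjHom (cs.wordProd ω') (cs.signedConj i (cs.simple i, 0)) = _
    simp [signedConj]
  -- If the word ω' of w s_i flipped the sign back, deleting a letter from it would give a word for
  -- w shorter than ℓ(w s_i), against the descent.
  have h2 : (cs.signedConjHom (cs.wordProd ω') (cs.simple i, 1)).2 = 1 := by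
    by_contra hne
    obtain ⟨p, x, r, rfl, hx⟩ := (cs.exists_of_signedConjHom_ne ω' _ _).2 hne
    have hlen : w = cs.wordProd (p ++ r) := by
      rw [cs.wordProd_append, cs.wordProd_cons] at hω'
      rw [cs.wordProd_append, ← mul_left_inj (cs.simple i), hω', hx, mul_assoc]
    have h3 := cs.length_wordProd_le (p ++ r)
    rw [← hlen] at h3
    have h4 := hr.eq
    rw [← hω'] at h4
    unfold IsRightDescent at h
    simp at h3 h4
    omega
  rw [e, h2]
  exact one_ne_zero

/-- The exchange property, on the left. -/
theorem exists_of_isLeftDescent {ω : List B} {i : B} (h : cs.IsLeftDescent (cs.wordProd ω) i) :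
    ∃ p x r, ω = p ++ x :: r ∧ cs.simple i * cs.wordProd p = cs.wordProd p * cs.simple x := by
  rw [← cs.isRightDescent_inv_iff, ← cs.wordProd_reverse] at h
  obtain ⟨p, x, r, hω, hx⟩ := cs.exists_of_isRightDescent h
  refine ⟨r.reverse, x, p.reverse, by simpa using congrArg List.reverse hω, ?_⟩
  rw [cs.wordProd_reverse]
  simpa using (congrArg Inv.inv hx).symm

/-! ### Alternating words and Matsumoto's theorem -/

/-- The word of length `n` that alternates between `i` and `j`, beginning with `i`. -/
def altWord : ℕ → B → B → List B
  | 0, _, _ => []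
  | n + 1, i, j => i :: altWord n j i

@[simp]
theorem length_altWord (n : ℕ) (i j : B) : (altWord n i j).length = n := by
  induction n generalizing i j with
  | zero => rfl
  | succ n ih => simp [altWord, ih]

theorem prod_map_altWord {A : Type*} [Monoid A] (f : B → A) (n : ℕ) (i j : B) :
    ((altWord n i j).map f).prod = altProd n (f i) (f j) := by
  induction n generalizing i j with
  | zero => rfl
  | succ n ih => simp [altWord, altProd, ih]

theorem altWord_eq_append_cons {n : ℕ} {i j x : B} {p r : List B}
    (h : altWord n i j = p ++ x :: r) :
    p = altWord p.length i j ∧ p ++ [x] = altWord (p.length + 1) i j := by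
  induction n generalizing i j p with
  | zero => simp [altWord] at h
  | succ n ih =>
    cases p with
    | nil =>
      simp only [altWord, List.nil_append, List.cons.injEq] at h
      simp [altWord, h.1]
    | cons y p =>
      simp only [altWord, List.cons_append, List.cons.injEq] at h
      obtain ⟨rfl, h⟩ := h
      obtain ⟨h1, h2⟩ := ih h
      constructor
      · simp only [List.length_cons, altWord, ← h1]
      · rw [List.length_cons, altWord, List.cons_append, h2]

theorem wordProd_altWord_mul_inv (n : ℕ) (i j : B) :
    cs.wordProd (altWord n i j) * (cs.wordProd (altWord n j i))⁻¹ =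
      (cs.simple i * cs.simple j) ^ n := by
  induction n generalizing i j with
  | zero => simp [altWord]
  | succ n ih =>
    rw [altWord, altWord, cs.wordProd_cons, cs.wordProd_cons, mul_inv_rev, mul_assoc,
      ← mul_assoc (cs.wordProd _), ih, cs.inv_simple, pow_succ', ← mul_assoc, mul_assoc,
      cs.simple_mul_simple_pow_mul_simple j i, mul_assoc]

theorem wordProd_altWord_swap (i j : B) :
    cs.wordProd (altWord (M i j) i j) = cs.wordProd (altWord (M i j) j i) := by
  rw [← mul_inv_eq_one, wordProd_altWord_mul_inv, cs.simple_mul_simple_pow]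

/-- Exchange lengthens the alternating prefix: put i in front of a reduced word that begins with j i
j ⋯ and delete a letter. The deleted letter cannot lie in the prefix, as that would make a power of
s_i s_j trivial too early. -/
theorem exists_altWord_append {w : W} {i j : B} (hij : i ≠ j) (hi : cs.IsLeftDescent w i)
    (hj : cs.IsLeftDescent w j) (n : ℕ) (hn : M i j = 0 ∨ n ≤ M i j) :
    (∃ a, cs.wordProd (altWord n i j ++ a) = w ∧ n + a.length = cs.length w) ∧
      ∃ a, cs.wordProd (altWord n j i ++ a) = w ∧ n + a.length = cs.length w := by
  induction n with
  | zero =>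
    obtain ⟨ω, hr, hω⟩ := cs.exists_isReduced w
    have := hr.eq
    simp only [altWord, List.nil_append, zero_add, and_self]
    exact ⟨ω, hω.symm, by rw [hω, this]⟩
  | succ n ih =>
    have step : ∀ {i j : B}, i ≠ j → cs.IsLeftDescent w i → (M i j = 0 ∨ n + 1 ≤ M i j) →
        (∃ a, cs.wordProd (altWord n j i ++ a) = w ∧ n + a.length = cs.length w) →
        ∃ a, cs.wordProd (altWord (n + 1) i j ++ a) = w ∧ n + 1 + a.length = cs.length w := by
      rintro i j hij hi hn ⟨a, ha, hlen⟩
      rw [← ha] at hi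
      obtain ⟨p, x, r, hpr, hx⟩ := cs.exists_of_isLeftDescent hi
      rcases List.append_eq_append_iff.mp hpr with ⟨a', rfl, rfl⟩ | ⟨c, hc, hc'⟩
      · refine ⟨a' ++ r, ?_, ?_⟩
        · rw [← ha, altWord, List.cons_append, cs.wordProd_cons, ← List.append_assoc,
            ← List.append_assoc, cs.wordProd_append _ r, cs.wordProd_append _ (x :: r),
            cs.wordProd_cons, ← mul_assoc, hx, mul_assoc]
        · simp at hlen ⊢
          omega
      · cases c with
        | nil =>
          simp only [List.append_nil, List.nil_append] at hc hc'
          subst hc'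
          subst hc
          refine ⟨r, ?_, ?_⟩
          · rw [← ha, altWord, List.cons_append, cs.wordProd_cons, cs.wordProd_append,
              cs.wordProd_append, cs.wordProd_cons, ← mul_assoc, hx, mul_assoc]
          · simp at hlen ⊢
            omega
        | cons y c =>
          simp only [List.cons_append, List.cons.injEq] at hc'
          obtain ⟨rfl, -⟩ := hc'
          obtain ⟨h1, h2⟩ := altWord_eq_append_cons hc
          -- Here the deleted letter lies in the alternating prefix. The exchange relation equates
          -- the two alternating words of length `p.length + 1 ≤ n < M i j` (or `M i j = 0`), so
          -- that power of s_i s_j would be 1.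
          exfalso
          have hlt : p.length + 1 ≤ n := by
            have := congrArg List.length hc
            simp at this
            omega
          refine cs.simple_mul_simple_pow_ne_one hij (Nat.succ_pos p.length) (by omega) ?_
          rw [Nat.succ_eq_add_one, ← wordProd_altWord_mul_inv, mul_inv_eq_one, ← h2, altWord, ← h1,
            cs.wordProd_append, cs.wordProd_singleton, cs.wordProd_cons, hx]
    obtain ⟨h1, h2⟩ := ih (by omega)
    exact ⟨step hij hi hn h2, step hij.symm hj (by rwa [M.symmetric]) h1⟩

/-- Matsumoto's theorem: a map to a monoid that satisfies the braid relations takes the same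
value on all reduced words of an element of a Coxeter group. -/
theorem prod_map_eq_of_isReduced {A : Type*} [Monoid A] {f : B → A}
    (hf : ∀ i j, 1 < M i j → altProd (M i j) (f i) (f j) = altProd (M i j) (f j) (f i))
    {ω ω' : List B} (h : cs.IsReduced ω) (h' : cs.IsReduced ω')
    (hω : cs.wordProd ω = cs.wordProd ω') : (ω.map f).prod = (ω'.map f).prod := by
  induction hn : ω.length using Nat.strong_induction_on generalizing ω ω' with
  | _ n ih =>
    have hlen : ω.length = ω'.length := by rw [← h.eq, ← h'.eq, hω]
    match ω, ω' with
    | [], [] => rfl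
    | [], _ :: _ => simp at hlen
    | _ :: _, [] => simp at hlen
    | i :: a, j :: b =>
      have tail : ∀ {k : B} {c : List B}, cs.IsReduced (k :: c) → cs.IsReduced c :=
        fun h => by simpa using h.drop 1
      have cancel : ∀ {k : B} {c d : List B}, (k :: c).length = n → cs.IsReduced (k :: c) →
          cs.IsReduced (k :: d) → cs.wordProd (k :: c) = cs.wordProd (k :: d) →
          ((k :: c).map f).prod = ((k :: d).map f).prod := by
        intro k c d hcn hc hd hcd
        rw [List.map_cons, List.map_cons, List.prod_cons, List.prod_cons,
          ih c.length (by rw [← hcn]; simp) (tail hc) (tail hd)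
            (by simpa [cs.wordProd_cons] using hcd) rfl]
      by_cases hij : i = j
      · subst hij
        exact cancel hn h h' hω
      have desc : ∀ {k : B} {c : List B}, cs.IsReduced (k :: c) →
          cs.IsLeftDescent (cs.wordProd (k :: c)) k := by
        intro k c hc
        unfold IsLeftDescent
        rw [hc.eq, cs.wordProd_cons, cs.simple_mul_simple_cancel_left, (tail hc).eq]
        simp
      have hi := desc h
      have hj := desc h'
      rw [← hω] at hj
      have hwn : cs.length (cs.wordProd (i :: a)) = n := h.eq.trans hn
      have key := cs.exists_altWord_append hij hi hj
      -- Were s_i s_j of infinite order, w would have alternating prefixes longer than its own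
      -- length n.
      have hM0 : M i j ≠ 0 := by
        intro h0
        obtain ⟨c, -, hc⟩ := (key (n + 1) (Or.inl h0)).1
        omega
      have hM1 := M.off_diagonal i j hij
      obtain ⟨⟨c, hc, hcl⟩, d, hd, hdl⟩ := key (M i j) (Or.inr le_rfl)
      have red : ∀ {e : List B}, cs.wordProd e = cs.wordProd (i :: a) → e.length = n →
          cs.IsReduced e := fun h1 h2 => by unfold IsReduced; rw [h1, h2, hwn]
      have hcr := red hc (by simp; omega)
      have hdr := red hd (by simp; omega)
      have suffix : ∀ {p e : List B}, cs.IsReduced (p ++ e) → cs.IsReduced e :=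
        fun {p e} h => by simpa using h.drop p.length
      have hcd : (c.map f).prod = (d.map f).prod := by
        refine ih c.length (by omega) (suffix hcr) (suffix hdr) ?_ rfl
        have := hc.trans hd.symm
        rw [cs.wordProd_append, cs.wordProd_append, wordProd_altWord_swap] at this
        exact mul_left_cancel this
      obtain ⟨m, hm⟩ := Nat.exists_eq_succ_of_ne_zero hM0
      -- Compare i::a with i j i ⋯ c, then with j i j ⋯ d, then with j::b. The outer pairs share a
      -- first letter and fall to induction; the middle pair differs by one braid relation.
      have h1 : ((i :: a).map f).prod = ((altWord (M i j) i j ++ c).map f).prod := by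
        rw [hm] at hcr hc ⊢
        exact cancel hn h hcr hc.symm
      have h2 : ((j :: b).map f).prod = ((altWord (M i j) j i ++ d).map f).prod := by
        rw [hm] at hdr hd ⊢
        exact cancel (hlen.symm.trans hn) h' hdr (hω.symm.trans hd.symm)
      rw [h1, h2, List.map_append, List.map_append, List.prod_append, List.prod_append,
        prod_map_altWord, prod_map_altWord, hcd, hf i j (by omega)]

end CoxeterSystem

/-! ### The operators T_w and the parabolic sum -/

namespace CoxeterSystem

section Monoid

variable {B W : Type*} [Group W] {M : CoxeterMatrix B} (cs : CoxeterSystem M W)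
  {A : Type*} [Monoid A] {f : B → A}

/-- The product of the values of `f` along a reduced word of `w`. -/
noncomputable def reducedProd (f : B → A) (w : W) : A :=
  ((cs.exists_isReduced w).choose.map f).prod

theorem reducedProd_wordProd
    (hf : ∀ i j, 1 < M i j → altProd (M i j) (f i) (f j) = altProd (M i j) (f j) (f i))
    {ω : List B} (h : cs.IsReduced ω) : cs.reducedProd f (cs.wordProd ω) = (ω.map f).prod :=
  have hc := (cs.exists_isReduced (cs.wordProd ω)).choose_spec
  cs.prod_map_eq_of_isReduced hf hc.1 h hc.2.symm

theorem reducedProd_one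
    (hf : ∀ i j, 1 < M i j → altProd (M i j) (f i) (f j) = altProd (M i j) (f j) (f i)) :
    cs.reducedProd f 1 = 1 := by
  rw [← cs.wordProd_nil, cs.reducedProd_wordProd hf (by simp [IsReduced])]
  rfl

theorem reducedProd_simple_mul
    (hf : ∀ i j, 1 < M i j → altProd (M i j) (f i) (f j) = altProd (M i j) (f j) (f i))
    {w : W} {i : B} (h : cs.length (cs.simple i * w) = cs.length w + 1) :
    cs.reducedProd f (cs.simple i * w) = f i * cs.reducedProd f w := by
  obtain ⟨ω, hr, rfl⟩ := cs.exists_isReduced w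
  have hr' : cs.IsReduced (i :: ω) := by
    unfold IsReduced
    rw [cs.wordProd_cons, h, hr.eq, List.length_cons]
  rw [← cs.wordProd_cons, cs.reducedProd_wordProd hf hr', cs.reducedProd_wordProd hf hr,
    List.map_cons, List.prod_cons]

theorem reducedProd_mul_simple
    (hf : ∀ i j, 1 < M i j → altProd (M i j) (f i) (f j) = altProd (M i j) (f j) (f i))
    {w : W} {i : B} (h : cs.length (w * cs.simple i) = cs.length w + 1) :
    cs.reducedProd f (w * cs.simple i) = cs.reducedProd f w * f i := by
  obtain ⟨ω, hr, rfl⟩ := cs.exists_isReduced w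
  have hr' : cs.IsReduced (ω ++ [i]) := by
    unfold IsReduced
    rw [cs.wordProd_append, cs.wordProd_singleton, h, hr.eq, List.length_append,
      List.length_singleton]
  rw [← cs.wordProd_singleton, ← cs.wordProd_append, cs.reducedProd_wordProd hf hr',
    cs.reducedProd_wordProd hf hr, List.map_append, List.prod_append, List.map_singleton,
    List.prod_singleton]

end Monoid

section Hecke

variable {B W : Type*} [Group W] {M : CoxeterMatrix B} (cs : CoxeterSystem M W)
  {K A : Type*} [Field K] [Ring A] [Algebra K A] {f : B → A} {q : K}

theorem mul_reducedProd
    (hf : ∀ i j, 1 < M i j → altProd (M i j) (f i) (f j) = altProd (M i j) (f j) (f i))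
    (hq : ∀ i, f i * f i = (q - 1) • f i + q • 1) (i : B) (w : W) :
    f i * cs.reducedProd f w = cs.reducedProd f (cs.simple i * w) ∨
      f i * cs.reducedProd f w =
        (q - 1) • cs.reducedProd f w + q • cs.reducedProd f (cs.simple i * w) := by
  rcases cs.length_simple_mul w i with h | h
  · exact Or.inl (cs.reducedProd_simple_mul hf h).symm
  · right
    have := cs.reducedProd_simple_mul hf (w := cs.simple i * w) (i := i) (by simp [h])
    rw [cs.simple_mul_simple_cancel_left] at this
    rw [this, ← mul_assoc, hq, add_mul, smul_mul_assoc, smul_mul_assoc, one_mul]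

open Classical in
theorem reducedProd_mul
    (hf : ∀ i j, 1 < M i j → altProd (M i j) (f i) (f j) = altProd (M i j) (f j) (f i))
    (hq : ∀ i, f i * f i = (q - 1) • f i + q • 1) (i : B) (w : W) :
    cs.reducedProd f w * f i =
      (if cs.IsRightDescent w i then q - 1 else 0) • cs.reducedProd f w +
        (if cs.IsRightDescent w i then q else 1) • cs.reducedProd f (w * cs.simple i) := by
  by_cases h : cs.IsRightDescent w i
  · rw [if_pos h, if_pos h]
    rw [cs.isRightDescent_iff] at h
    have := cs.reducedProd_mul_simple hf (w := w * cs.simple i) (i := i) (by simp [h])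
    rw [cs.simple_mul_simple_cancel_right] at this
    rw [this, mul_assoc, hq, mul_add, mul_smul_comm, mul_smul_comm, mul_one]
  · rw [if_neg h, if_neg h]
    rw [cs.not_isRightDescent_iff] at h
    rw [cs.reducedProd_mul_simple hf h, zero_smul, one_smul, zero_add]

open Classical in
/-- The sum of the basis elements of the Hecke algebra over a parabolic subgroup. -/
noncomputable def parabolicSum [Fintype W] (f : B → A) (J : Set B) : A :=
  ∑ w : W with w ∈ cs.parabolic J, cs.reducedProd f w

theorem simple_mem_parabolic {J : Set B} {i : B} (hi : i ∈ J) : cs.simple i ∈ cs.parabolic J :=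
  Subgroup.subset_closure ⟨i, hi, rfl⟩

/-- Right multiplication by s_i permutes W_J and exchanges descents with non-descents. After
reindexing, T_w has coefficient (q - 1) + 1 if i is a right descent of w and 0 + q otherwise. -/
theorem parabolicSum_mul [Fintype W]
    (hf : ∀ i j, 1 < M i j → altProd (M i j) (f i) (f j) = altProd (M i j) (f j) (f i))
    (hq : ∀ i, f i * f i = (q - 1) • f i + q • 1) {J : Set B} {i : B} (hi : i ∈ J) :
    cs.parabolicSum f J * f i = q • cs.parabolicSum f J := by
  classical
  have hinv : ∑ w : W with w ∈ cs.parabolic J, (if cs.IsRightDescent w i then q else 1) •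
        cs.reducedProd f (w * cs.simple i) =
      ∑ w : W with w ∈ cs.parabolic J, (if cs.IsRightDescent w i then 1 else q) •
        cs.reducedProd f w := by
    refine Finset.sum_nbij' (· * cs.simple i) (· * cs.simple i) ?_ ?_ ?_ ?_ ?_
    · intro w hw
      simp only [Finset.mem_filter, Finset.mem_univ, true_and] at hw ⊢
      exact mul_mem hw (cs.simple_mem_parabolic hi)
    · intro w hw
      simp only [Finset.mem_filter, Finset.mem_univ, true_and] at hw ⊢
      exact mul_mem hw (cs.simple_mem_parabolic hi)
    · simp
    · simp
    · intro w _
      by_cases h : cs.IsRightDescent w i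
      · rw [if_pos h, if_neg (cs.isRightDescent_iff_not_isRightDescent_mul.mp h)]
      · rw [if_neg h, if_pos]
        by_contra h'
        exact h (cs.isRightDescent_iff_not_isRightDescent_mul.mpr h')
  rw [parabolicSum, Finset.sum_mul, Finset.smul_sum]
  simp_rw [cs.reducedProd_mul hf hq]
  rw [Finset.sum_add_distrib, hinv, ← Finset.sum_add_distrib]
  refine Finset.sum_congr rfl fun w _ => ?_
  rw [← add_smul]
  congr 1
  split_ifs <;> ring

/-- For i in J, passing from v to s_i v multiplies e T_v by q or by q⁻¹, according to the length. So
no minimal coset representatives are needed. -/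
theorem parabolicSum_mul_reducedProd_mem_span [Fintype W]
    (hf : ∀ i j, 1 < M i j → altProd (M i j) (f i) (f j) = altProd (M i j) (f j) (f i))
    (hq : ∀ i, f i * f i = (q - 1) • f i + q • 1) (hq0 : q ≠ 0) {J : Set B} {x : W}
    (hx : x ∈ cs.parabolic J) (w : W) :
    cs.parabolicSum f J * cs.reducedProd f (x * w) ∈
      Submodule.span K {cs.parabolicSum f J * cs.reducedProd f w} := by
  have step : ∀ i ∈ J, ∀ v : W, cs.parabolicSum f J * cs.reducedProd f (cs.simple i * v) ∈
      Submodule.span K {cs.parabolicSum f J * cs.reducedProd f v} := by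
    intro i hi v
    rw [Submodule.mem_span_singleton]
    rcases cs.length_simple_mul v i with h | h
    · refine ⟨q, ?_⟩
      rw [cs.reducedProd_simple_mul hf h, ← mul_assoc, cs.parabolicSum_mul hf hq hi,
        smul_mul_assoc]
    · refine ⟨q⁻¹, ?_⟩
      have := cs.reducedProd_simple_mul hf (w := cs.simple i * v) (i := i) (by simp [h])
      rw [cs.simple_mul_simple_cancel_left] at this
      rw [this, ← mul_assoc, cs.parabolicSum_mul hf hq hi, smul_mul_assoc, inv_smul_smul₀ hq0]
  have gen : ∀ y : W, ∀ i ∈ J,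
      cs.parabolicSum f J * cs.reducedProd f (y * w) ∈
        Submodule.span K {cs.parabolicSum f J * cs.reducedProd f w} →
      cs.parabolicSum f J * cs.reducedProd f (cs.simple i * y * w) ∈
        Submodule.span K {cs.parabolicSum f J * cs.reducedProd f w} := by
    intro y i hi hy
    rw [mul_assoc]
    exact (Submodule.span_singleton_le_iff_mem _ _).mpr hy (step i hi (y * w))
  induction hx using Subgroup.closure_induction_left with
  | one =>
    rw [one_mul]
    exact Submodule.mem_span_singleton_self _
  | mul_left x hx y _ hy =>
    obtain ⟨i, hi, rfl⟩ := hx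
    exact gen y i hi hy
  | inv_mul_cancel x hx y _ hy =>
    obtain ⟨i, hi, rfl⟩ := hx
    rw [cs.inv_simple]
    exact gen y i hi hy

end Hecke

section Representation

variable {B W : Type*} [Group W] {M : CoxeterMatrix B} (cs : CoxeterSystem M W)
  {K V : Type*} [Field K] [AddCommGroup V] [Module K V] {f : B → Module.End K V} {q : K}

theorem reducedProd_apply_eq_smul
    (hf : ∀ i j, 1 < M i j → altProd (M i j) (f i) (f j) = altProd (M i j) (f j) (f i))
    (hq : ∀ i, f i * f i = (q - 1) • f i + q • 1) (hq0 : q ≠ 0) {J : Set B}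
    {v : V} (hv : ∀ i ∈ J, f i v = q • v) {w : W} (hw : w ∈ cs.parabolic J) :
    cs.reducedProd f w v = q ^ cs.length w • v := by
  have gen : ∀ y : W, ∀ i ∈ J, cs.reducedProd f y v = q ^ cs.length y • v →
      cs.reducedProd f (cs.simple i * y) v = q ^ cs.length (cs.simple i * y) • v := by
    intro y i hi hy
    rcases cs.length_simple_mul y i with h | h
    · rw [cs.reducedProd_simple_mul hf h, Module.End.mul_apply, hy, map_smul, hv i hi, h, pow_succ,
        mul_smul]
    · have h1 := cs.reducedProd_simple_mul hf (w := cs.simple i * y) (i := i) (by simp [h])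
      rw [cs.simple_mul_simple_cancel_left] at h1
      -- When s_i shortens y, the formula is obtained by cancelling T_i, which is injective: by the
      -- quadratic relation a vector x in its kernel satisfies q x = 0.
      have hker : f i (cs.reducedProd f (cs.simple i * y) v -
          q ^ cs.length (cs.simple i * y) • v) = 0 := by
        rw [map_sub, ← Module.End.mul_apply, ← h1, hy, map_smul, hv i hi, ← h, pow_succ, mul_smul,
          sub_self]
      have h2 := LinearMap.congr_fun (hq i) (cs.reducedProd f (cs.simple i * y) v -
          q ^ cs.length (cs.simple i * y) • v)
      rw [Module.End.mul_apply, LinearMap.add_apply, LinearMap.smul_apply, LinearMap.smul_apply,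
        hker, map_zero, smul_zero, zero_add, Module.End.one_apply] at h2
      exact sub_eq_zero.mp ((smul_eq_zero.mp h2.symm).resolve_left hq0)
  induction hw using Subgroup.closure_induction_left with
  | one => rw [cs.reducedProd_one hf, cs.length_one, pow_zero, one_smul, Module.End.one_apply]
  | mul_left x hx y _ hy =>
    obtain ⟨i, hi, rfl⟩ := hx
    exact gen y i hi hy
  | inv_mul_cancel x hx y _ hy =>
    obtain ⟨i, hi, rfl⟩ := hx
    rw [cs.inv_simple]
    exact gen y i hi hy

end Representation

end CoxeterSystem

/-! ### Nonvanishing in ℚ(u) and the Hecke relations -/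

theorem heckeU_ne_zero : heckeU ≠ 0 := RatFunc.X_ne_zero

theorem heckeU_eq_algebraMap : heckeU = algebraMap (Polynomial ℚ) (RatFunc ℚ) Polynomial.X :=
  RatFunc.algebraMap_X.symm

theorem sum_heckeU_sq_pow_ne_zero {ι : Type*} {s : Finset ι} (hs : s.Nonempty) (n : ι → ℕ) :
    ∑ i ∈ s, (heckeU ^ 2) ^ n i ≠ 0 := by
  have h : ∑ i ∈ s, (heckeU ^ 2) ^ n i =
      algebraMap (Polynomial ℚ) (RatFunc ℚ) (∑ i ∈ s, (Polynomial.X ^ 2) ^ n i) := by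
    simp [heckeU_eq_algebraMap]
  rw [h]
  intro h0
  have h1 := (map_eq_zero_iff _ (RatFunc.algebraMap_injective ℚ)).mp h0
  -- At u = 1 the sum is the number of its terms, nonzero in characteristic 0.
  have h2 := congrArg (Polynomial.eval 1) h1
  simp [Polynomial.eval_finsetSum] at h2
  exact hs.ne_empty h2

theorem heckeU_add_one_ne_zero : heckeU + 1 ≠ 0 := by
  have h : heckeU + 1 = algebraMap (Polynomial ℚ) (RatFunc ℚ) (Polynomial.X + 1) := by
    simp [heckeU_eq_algebraMap]
  rw [h]
  intro h0
  have h1 := (map_eq_zero_iff _ (RatFunc.algebraMap_injective ℚ)).mp h0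
  simpa using congrArg (Polynomial.eval 0) h1

theorem heckeU_sub_one_ne_zero : heckeU - 1 ≠ 0 := by
  have h : heckeU - 1 = algebraMap (Polynomial ℚ) (RatFunc ℚ) (Polynomial.X - 1) := by
    simp [heckeU_eq_algebraMap]
  rw [h]
  intro h0
  have h1 := (map_eq_zero_iff _ (RatFunc.algebraMap_injective ℚ)).mp h0
  simpa using congrArg (Polynomial.eval 0) h1

theorem map_altProd {A C F : Type*} [Monoid A] [Monoid C] [FunLike F A C] [MonoidHomClass F A C]
    (φ : F) (n : ℕ) (a b : A) : φ (altProd n a b) = altProd n (φ a) (φ b) := by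
  induction n generalizing a b with
  | zero => exact map_one φ
  | succ n ih => simp only [altProd, map_mul, ih]

theorem mul_self_eq_of_sub_mul_add_one_eq_zero {K A : Type*} [Field K] [Ring A] [Algebra K A]
    {q : K} {a : A} (h : (a - algebraMap K A q) * (a + 1) = 0) : a * a = (q - 1) • a + q • 1 := by
  rw [Algebra.algebraMap_eq_smul_one] at h
  rw [← sub_eq_zero, ← h]
  simp only [sub_mul, mul_add, smul_mul_assoc, one_mul, mul_one, sub_smul, one_smul]
  abel

theorem heckeT_quadratic {B : Type*} (M : CoxeterMatrix B) (s : B) :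
    (heckeT M s - algebraMap (RatFunc ℚ) (HeckeAlgebra M) (heckeU ^ 2)) * (heckeT M s + 1) = 0 := by
  have h := RingQuot.mkAlgHom_rel (RatFunc ℚ) (HeckeRel.quadratic (M := M) s)
  rwa [map_mul, map_sub, map_add, map_one, map_zero, AlgHom.commutes] at h

theorem altProd_heckeT {B : Type*} (M : CoxeterMatrix B) {s t : B} (hst : 1 < M s t) :
    altProd (M s t) (heckeT M s) (heckeT M t) = altProd (M s t) (heckeT M t) (heckeT M s) := by
  have h := RingQuot.mkAlgHom_rel (RatFunc ℚ) (HeckeRel.braid (M := M) s t hst)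
  rwa [map_altProd, map_altProd] at h

/-! ### The operators τ_s on the vertices -/

namespace LabeledDigraph

variable {S V E : Type*} (Γ : LabeledDigraph S V E)

theorem tau_single (s : S) (α : V) : Γ.tau s (Finsupp.single α 1) = Γ.tauVertex s α := by
  simp [tau]

theorem IsWDigraph.tau_mul_self {M : CoxeterMatrix S} {Γ : LabeledDigraph S V E}
    (h : Γ.IsWDigraph M) (s : S) :
    Γ.tau s * Γ.tau s = (heckeU ^ 2 - 1) • Γ.tau s + heckeU ^ 2 • 1 := by
  obtain ⟨ρ, hρ⟩ := h
  have h := congrArg ρ (heckeT_quadratic M s)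
  rw [map_mul, map_sub, map_add, map_one, map_zero, AlgHom.commutes, hρ] at h
  exact mul_self_eq_of_sub_mul_add_one_eq_zero
    (A := Module.End (RatFunc ℚ) (V →₀ RatFunc ℚ)) h

theorem IsWDigraph.altProd_tau {M : CoxeterMatrix S} {Γ : LabeledDigraph S V E}
    (h : Γ.IsWDigraph M) (s t : S) (hst : 1 < M s t) :
    altProd (M s t) (Γ.tau s) (Γ.tau t) = altProd (M s t) (Γ.tau t) (Γ.tau s) := by
  obtain ⟨ρ, hρ⟩ := h
  rw [← hρ, ← hρ, ← map_altProd, altProd_heckeT M hst, map_altProd]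

theorem label_edgeAt (s : S) (v : V) : Γ.label (Γ.edgeAt s v) = s :=
  (Γ.existsUnique_edge s v).choose_spec.1.1

theorem src_or_tgt_edgeAt (s : S) (v : V) :
    Γ.src (Γ.edgeAt s v) = v ∨ Γ.tgt (Γ.edgeAt s v) = v :=
  (Γ.existsUnique_edge s v).choose_spec.1.2

theorem edgeAt_eq {s : S} {v : V} {e : E} (hs : Γ.label e = s) (hv : Γ.src e = v ∨ Γ.tgt e = v) :
    Γ.edgeAt s v = e :=
  ((Γ.existsUnique_edge s v).choose_spec.2 e ⟨hs, hv⟩).symm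

open Classical in
/-- The other end of the edge labeled `s` at `v`. -/
noncomputable def partner (s : S) (v : V) : V :=
  if Γ.src (Γ.edgeAt s v) = v then Γ.tgt (Γ.edgeAt s v) else Γ.src (Γ.edgeAt s v)

theorem edgeAt_partner (s : S) (v : V) : Γ.edgeAt s (Γ.partner s v) = Γ.edgeAt s v := by
  apply Γ.edgeAt_eq (Γ.label_edgeAt s v)
  unfold partner
  split_ifs
  · exact Or.inr rfl
  · exact Or.inl rfl

theorem partner_partner (s : S) (v : V) : Γ.partner s (Γ.partner s v) = v := by
  rw [partner, edgeAt_partner]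
  have hl := Γ.no_loops (Γ.edgeAt s v)
  by_cases h : Γ.src (Γ.edgeAt s v) = v
  · rw [show Γ.partner s v = Γ.tgt (Γ.edgeAt s v) by rw [partner, if_pos h], if_neg hl, h]
  · rw [show Γ.partner s v = Γ.src (Γ.edgeAt s v) by rw [partner, if_neg h], if_pos rfl]
    exact (Γ.src_or_tgt_edgeAt s v).resolve_left h

theorem undir_adj_iff {v w : V} : Γ.undir.Adj v w ↔ ∃ s, Γ.partner s v = w := by
  constructor
  · rintro ⟨e, ⟨h1, h2⟩ | ⟨h1, h2⟩⟩
    · refine ⟨Γ.label e, ?_⟩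
      rw [partner, Γ.edgeAt_eq rfl (Or.inl h1), if_pos h1, h2]
    · refine ⟨Γ.label e, ?_⟩
      rw [partner, Γ.edgeAt_eq rfl (Or.inr h2), if_neg, h1]
      rw [← h2]
      exact Γ.no_loops e
  · rintro ⟨s, rfl⟩
    refine ⟨Γ.edgeAt s v, ?_⟩
    by_cases h : Γ.src (Γ.edgeAt s v) = v
    · rw [partner, if_pos h]
      exact Or.inl ⟨h, rfl⟩
    · rw [partner, if_neg h]
      exact Or.inr ⟨rfl, (Γ.src_or_tgt_edgeAt s v).resolve_left h⟩

theorem restrict_partner (J : Set S) (s : J) (v : V) :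
    (Γ.restrict J).partner s v = Γ.partner s v := by
  have h : Γ.edgeAt s v = ((Γ.restrict J).edgeAt s v).1 :=
    Γ.edgeAt_eq (congrArg Subtype.val ((Γ.restrict J).label_edgeAt s v))
      ((Γ.restrict J).src_or_tgt_edgeAt s v)
  unfold partner
  simp only [h]
  congr 1
  exact congrArg (Γ.src · = v) h.symm

open Classical in
/-- The coefficient of `v` in `τ_s(v)`. -/
noncomputable def selfCoeff (s : S) (v : V) : RatFunc ℚ :=
  if Γ.src (Γ.edgeAt s v) = v then
    if Γ.IsDashed (Γ.edgeAt s v) then heckeU else 0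
  else if Γ.IsDashed (Γ.edgeAt s v) then heckeU ^ 2 - heckeU - 1 else heckeU ^ 2 - 1

open Classical in
/-- The coefficient of the other end of the edge labeled `s` at `v` in `τ_s(v)`. -/
noncomputable def partnerCoeff (s : S) (v : V) : RatFunc ℚ :=
  if Γ.src (Γ.edgeAt s v) = v then
    if Γ.IsDashed (Γ.edgeAt s v) then heckeU + 1 else 1
  else if Γ.IsDashed (Γ.edgeAt s v) then heckeU ^ 2 - heckeU else heckeU ^ 2

theorem tauVertex_eq (s : S) (v : V) :
    Γ.tauVertex s v = Finsupp.single v (Γ.selfCoeff s v) +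
      Finsupp.single (Γ.partner s v) (Γ.partnerCoeff s v) := by
  unfold tauVertex selfCoeff partnerCoeff partner
  dsimp only
  split_ifs <;> simp

theorem partnerCoeff_ne_zero (s : S) (v : V) : Γ.partnerCoeff s v ≠ 0 := by
  unfold partnerCoeff
  split_ifs
  · exact heckeU_add_one_ne_zero
  · exact one_ne_zero
  · rw [show heckeU ^ 2 - heckeU = heckeU * (heckeU - 1) by ring]
    exact mul_ne_zero heckeU_ne_zero heckeU_sub_one_ne_zero
  · exact pow_ne_zero 2 heckeU_ne_zero

/-- The left side is the coefficient of v in τ_s(v + v'), with v' the other end of the edge. Thus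
the sum of the two ends is an eigenvector, whatever the type and direction of the edge. -/
theorem selfCoeff_add_partnerCoeff_partner (s : S) (v : V) :
    Γ.selfCoeff s v + Γ.partnerCoeff s (Γ.partner s v) = heckeU ^ 2 := by
  have hl := Γ.no_loops (Γ.edgeAt s v)
  rw [selfCoeff, partnerCoeff, edgeAt_partner]
  by_cases h : Γ.src (Γ.edgeAt s v) = v
  · rw [show Γ.partner s v = Γ.tgt (Γ.edgeAt s v) by rw [partner, if_pos h], if_neg hl, if_pos h]
    split_ifs <;> ring
  · rw [show Γ.partner s v = Γ.src (Γ.edgeAt s v) by rw [partner, if_neg h], if_pos rfl, if_neg h]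
    split_ifs <;> ring

open Classical in
/-- The sum of the vertices of a set that is closed under passing to the other end of the edge
labeled `s` is an eigenvector of `τ_s`. -/
theorem tau_sum_single (s : S) {C : Finset V} (hC : ∀ v ∈ C, Γ.partner s v ∈ C) :
    Γ.tau s (∑ v ∈ C, Finsupp.single v 1) = heckeU ^ 2 • ∑ v ∈ C, Finsupp.single v 1 := by
  have hsum : ∑ v ∈ C, Finsupp.single (Γ.partner s v) (Γ.partnerCoeff s v) =
      ∑ v ∈ C, Finsupp.single v (Γ.partnerCoeff s (Γ.partner s v)) :=
    Finset.sum_nbij' (Γ.partner s) (Γ.partner s) hC hC (fun v _ => Γ.partner_partner s v)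
      (fun v _ => Γ.partner_partner s v) (fun v _ => by rw [partner_partner])
  rw [map_sum, Finset.smul_sum]
  simp_rw [tau_single, tauVertex_eq]
  rw [Finset.sum_add_distrib, hsum, ← Finset.sum_add_distrib]
  refine Finset.sum_congr rfl fun v _ => ?_
  rw [← Finsupp.single_add, selfCoeff_add_partnerCoeff_partner, Finsupp.smul_single, smul_eq_mul,
    mul_one]

/-- From a vertex in N, applying τ_s and subtracting the multiple of that vertex leaves a nonzero
multiple of its neighbour; connectedness carries this to all vertices. -/
theorem eq_top_of_tau_mem (hconn : Γ.IsConnected) {N : Submodule (RatFunc ℚ) (V →₀ RatFunc ℚ)}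
    (hN : ∀ s, ∀ x ∈ N, Γ.tau s x ∈ N) {v : V} (hv : Finsupp.single v 1 ∈ N) : N = ⊤ := by
  have step : ∀ {a b : V}, Γ.undir.Adj a b → Finsupp.single a 1 ∈ N → Finsupp.single b 1 ∈ N := by
    intro a b hab ha
    obtain ⟨s, rfl⟩ := Γ.undir_adj_iff.mp hab
    have h := hN s _ ha
    rw [tau_single, tauVertex_eq] at h
    have h1 : Finsupp.single a (Γ.selfCoeff s a) ∈ N := by
      simpa using N.smul_mem (Γ.selfCoeff s a) ha
    have h2 := N.smul_mem (Γ.partnerCoeff s a)⁻¹ ((N.add_mem_iff_right h1).mp h)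
    simpa [Γ.partnerCoeff_ne_zero] using h2
  have all : ∀ w, Finsupp.single w 1 ∈ N := by
    intro w
    obtain ⟨p⟩ := hconn.preconnected v w
    induction p with
    | nil => exact hv
    | cons h _ ih => exact ih (step h hv)
  rw [eq_top_iff]
  intro x _
  induction x using Finsupp.induction_linear with
  | zero => exact N.zero_mem
  | add x y hx hy => exact N.add_mem (hx trivial) (hy trivial)
  | single w c => simpa using N.smul_mem c (all w)

end LabeledDigraph

/-! ### Component sums and the dimension count -/

namespace LabeledDigraph

variable {B W : Type*} [Group W] {M : CoxeterMatrix B} (cs : CoxeterSystem M W) {V E : Type*}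
  {Γ : LabeledDigraph B V E}

theorem span_reducedProd_tau_eq_top (hΓ : Γ.IsWDigraph M) (hconn : Γ.IsConnected) (v : V) :
    Submodule.span (RatFunc ℚ)
      (Set.range fun w : W => cs.reducedProd Γ.tau w (Finsupp.single v 1)) = ⊤ := by
  refine Γ.eq_top_of_tau_mem hconn (fun s x hx => ?_) (v := v) ?_
  · induction hx using Submodule.span_induction with
    | mem x hx =>
      obtain ⟨w, rfl⟩ := hx
      dsimp only
      rw [← Module.End.mul_apply]
      have hmem := fun y : W => Submodule.subset_span (R := RatFunc ℚ)
        (Set.mem_range_self (f := fun w : W => cs.reducedProd Γ.tau w (Finsupp.single v 1)) y)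
      rcases cs.mul_reducedProd (A := Module.End (RatFunc ℚ) (V →₀ RatFunc ℚ)) hΓ.altProd_tau
        hΓ.tau_mul_self s w with h | h
      · rw [h]
        exact hmem _
      · rw [h]
        exact Submodule.add_mem _ (Submodule.smul_mem _ _ (hmem _))
          (Submodule.smul_mem _ _ (hmem _))
    | zero => simp
    | add x y _ _ hx hy => rw [map_add]; exact Submodule.add_mem _ hx hy
    | smul c x _ hx => rw [map_smul]; exact Submodule.smul_mem _ c hx
  · refine Submodule.subset_span ⟨1, ?_⟩
    simp only [cs.reducedProd_one hΓ.altProd_tau, Module.End.one_apply]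

theorem finite_vertices [Finite W] (cs : CoxeterSystem M W) (hΓ : Γ.IsWDigraph M)
    (hconn : Γ.IsConnected) : Finite V := by
  obtain ⟨v⟩ := hconn.nonempty
  have : Module.Finite (RatFunc ℚ) (V →₀ RatFunc ℚ) :=
    ⟨Submodule.fg_def.mpr ⟨_, Set.finite_range _, span_reducedProd_tau_eq_top cs hΓ hconn v⟩⟩
  exact Module.Finite.finite_basis (Finsupp.basisSingleOne (R := RatFunc ℚ) (ι := V))

open Classical in
/-- The sum of the vertices of a connected component. -/
noncomputable def componentSum [Fintype V] (C : Γ.Component) : V →₀ RatFunc ℚ :=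
  ∑ v : V with Γ.undir.connectedComponentMk v = C, Finsupp.single v 1

open Classical in
theorem componentSum_apply [Fintype V] (C : Γ.Component) (v : V) :
    componentSum C v = if Γ.undir.connectedComponentMk v = C then 1 else 0 := by
  rw [componentSum, Finsupp.finsetSum_apply]
  simp [Finsupp.single_apply]

theorem linearIndependent_componentSum [Fintype V] :
    LinearIndependent (RatFunc ℚ) (componentSum : Γ.Component → V →₀ RatFunc ℚ) := by
  classical
  rw [linearIndependent_iff']
  intro s c hc C hC
  induction C using SimpleGraph.ConnectedComponent.ind with
  | _ v =>
    have := DFunLike.congr_fun hc v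
    simpa [Finsupp.finsetSum_apply, componentSum_apply, hC] using this

theorem tau_componentSum_restrict [Fintype V] {J : Set B} (C : (Γ.restrict J).Component) {s : B}
    (hs : s ∈ J) : Γ.tau s (componentSum C) = heckeU ^ 2 • componentSum C := by
  classical
  refine Γ.tau_sum_single s fun v hv => ?_
  simp only [Finset.mem_filter, Finset.mem_univ, true_and] at hv ⊢
  rw [← hv, SimpleGraph.ConnectedComponent.eq]
  refine SimpleGraph.Adj.reachable (SimpleGraph.Adj.symm ?_)
  rw [undir_adj_iff]
  exact ⟨⟨s, hs⟩, Γ.restrict_partner J ⟨s, hs⟩ v⟩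

/-- The span contains the image of the parabolic sum, and each component sum is in that image
because the parabolic sum scales it by a nonzero factor. -/
theorem range_componentSum_subset_span [Fintype W] [Fintype V] (hΓ : Γ.IsWDigraph M)
    (hconn : Γ.IsConnected) (J : Set B) (v : V) :
    Set.range (componentSum : (Γ.restrict J).Component → V →₀ RatFunc ℚ) ⊆
      Submodule.span (RatFunc ℚ) (Set.range fun c : W ⧸ cs.parabolic J =>
        (cs.parabolicSum Γ.tau J * cs.reducedProd Γ.tau c.out⁻¹) (Finsupp.single v 1)) := by
  classical
  rintro _ ⟨C, rfl⟩
  set P := Submodule.span (RatFunc ℚ) (Set.range fun c : W ⧸ cs.parabolic J =>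
        (cs.parabolicSum Γ.tau J * cs.reducedProd Γ.tau c.out⁻¹) (Finsupp.single v 1))
  have hu : heckeU ^ 2 ≠ 0 := pow_ne_zero 2 heckeU_ne_zero
  have hP : ∀ x, cs.parabolicSum Γ.tau J x ∈ P := by
    intro x
    have hx : x ∈ Submodule.span (RatFunc ℚ)
        (Set.range fun w : W => cs.reducedProd Γ.tau w (Finsupp.single v 1)) := by
      rw [span_reducedProd_tau_eq_top cs hΓ hconn v]
      trivial
    induction hx using Submodule.span_induction with
    | mem x hx =>
      obtain ⟨w, rfl⟩ := hx
      -- The quotient consists of left cosets, while the cosets W_J w are needed; inverting w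
      -- translates one into the other.
      obtain ⟨g, hg⟩ := QuotientGroup.mk_out_eq_mul (cs.parabolic J) w⁻¹
      have hw : w = g * (((w⁻¹ : W) : W ⧸ cs.parabolic J).out)⁻¹ := by
        rw [hg]
        simp
      have h := cs.parabolicSum_mul_reducedProd_mem_span
        (A := Module.End (RatFunc ℚ) (V →₀ RatFunc ℚ)) hΓ.altProd_tau hΓ.tau_mul_self hu g.2
        (((w⁻¹ : W) : W ⧸ cs.parabolic J).out)⁻¹
      rw [← hw] at h
      obtain ⟨c, hc⟩ := Submodule.mem_span_singleton.mp h
      dsimp only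
      rw [← Module.End.mul_apply, ← hc, LinearMap.smul_apply]
      exact P.smul_mem c (Submodule.subset_span ⟨_, rfl⟩)
    | zero => rw [map_zero]; exact P.zero_mem
    | add x y _ _ hx hy => rw [map_add]; exact P.add_mem hx hy
    | smul c x _ hx => rw [map_smul]; exact P.smul_mem c hx
  have heig : cs.parabolicSum Γ.tau J (componentSum C) =
      (∑ w : W with w ∈ cs.parabolic J, (heckeU ^ 2) ^ cs.length w) • componentSum C := by
    rw [CoxeterSystem.parabolicSum, LinearMap.sum_apply, Finset.sum_smul]
    refine Finset.sum_congr rfl fun w hw => ?_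
    exact cs.reducedProd_apply_eq_smul hΓ.altProd_tau hΓ.tau_mul_self hu
      (fun s hs => tau_componentSum_restrict C hs) (by simpa using hw)
  have h := hP (componentSum C)
  rw [heig] at h
  exact (P.smul_mem_iff (sum_heckeU_sq_pow_ne_zero ⟨1, by simp [one_mem]⟩ _)).mp h

end LabeledDigraph

theorem theorem6 {B W : Type*} [Group W] [Finite W] {M : CoxeterMatrix B}
    (cs : CoxeterSystem M W) (J : Set B)
    {V E : Type*} (Γ : LabeledDigraph B V E)
    (hΓ : Γ.IsWDigraph M) (hconn : Γ.IsConnected) :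
    Finite (Γ.restrict J).Component ∧
      Nat.card (Γ.restrict J).Component ≤ (cs.parabolic J).index := by
  classical
  have := LabeledDigraph.finite_vertices cs hΓ hconn
  have := Fintype.ofFinite V
  have := Fintype.ofFinite W
  have hfin : Finite (Γ.restrict J).Component := inferInstance
  refine ⟨hfin, ?_⟩
  have := Fintype.ofFinite (Γ.restrict J).Component
  have := Fintype.ofFinite (W ⧸ cs.parabolic J)
  obtain ⟨v⟩ := hconn.nonempty
  have h := linearIndependent_le_span_aux' _
    (LabeledDigraph.linearIndependent_componentSum (Γ := Γ.restrict J)) _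
    (LabeledDigraph.range_componentSum_subset_span cs hΓ hconn J v)
  rw [Nat.card_eq_fintype_card, Subgroup.index, Nat.card_eq_fintype_card]
  exact h.trans (Fintype.card_range_le _)
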